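/- For $n\ge 0$ let $S_n$ be the set of permutations of $\{1,\dots,n\}$ (with $S_0=\{\emptyset\}$), written in one-line notation $w=w(1)\cdots w(n)$. For $w\in S_n$ let $\mathfrak S_w$ be its Schubert polynomial, i.e. $\mathfrak S_{n\cdots 21}=x_1^{n-1}x_2^{n-2}\cdots x_{n-1}$ and $\mathfrak S_w=\partial_i\,\mathfrak S_{ws_i}$ whenever $w(i)<w(i+1)$, where $ws_i$ is $w$ with $w(i)$ and $w(i+1)$ interchanged, and $\partial_i f=\dfrac{f-s_if}{x_i-x_{i+1}}$ with $s_i$ interchanging the variables $x_i$ and $x_{i+1}$. Put $\Upsilon_w=\mathfrak S_w(1,1,\dots,1)$. For words $u,v$ of distinct positive integers write $u\le v$ if $u$ is a (possibly empty, not necessarily contiguous) subword of $v$; $|u|$ is the number of entries of $u$, and $\mathrm{perm}(u)\in S_{|u|}$ is the permutation whose entries have the same relative order as those of $u$. For permutations $v,w$ let $p_v(w)$ be the number of subwords of $w$ whose $\mathrm{perm}$ is $v$; $w$ avoids $1423$ if $p_{1423}(w)=0$. Define integers $c_w$ recursively by $c_\emptyset=1$ and, for $w\in S_n$ with $n\ge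 1$, $$c_w=\Upsilon_w-\sum_{0\le m<n}\ \sum_{v\in S_m}c_v\,p_v(w).$$ **Corollary.** Let $w\in S_n$ be a permutation avoiding $1423$. (1) (The Mészáros–Tanjaya conjecture for $w$.) For every subword $u$ of $w$, $$\sum_{u\le v\le w}(-1)^{|w|-|v|}\,\Upsilon_{\mathrm{perm}(v)}\ \ge\ 0 .$$ (2) (Gao's conjecture for $w$.) We have $c_w\ge 0$. Moreover $$\Upsilon_w=\sum_{0\le m\le n}\ \sum_{v\in S_m}c_v\,p_v(w),$$ and $c_v\ge 0$ for every permutation $v$ with $p_v(w)>0$. -/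

import Mathlib

noncomputable section

namespace SchubertSpec

open MvPolynomial

/-! ### Schubert polynomials

`S_n` is `Equiv.Perm (Fin n)`; positions and values are counted from `0`, and the variable called
`x_{i+1}` in the usual notation is `X i`. -/

/-- The action of the simple transposition exchanging the variables `X i` and `X (i + 1)`. -/
def swapVars (i : ℕ) (f : MvPolynomial ℕ ℤ) : MvPolynomial ℕ ℤ :=
  rename (Equiv.swap i (i + 1)) f

theorem dvd_sub_swapVars (i : ℕ) (f : MvPolynomial ℕ ℤ) :
    (X i - X (i + 1) : MvPolynomial ℕ ℤ) ∣ f - swapVars i f := by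
  unfold swapVars
  induction f using MvPolynomial.induction_on with
  | C a => simp
  | add p q hp hq =>
    have h := dvd_add hp hq
    rw [map_add]
    convert h using 1
    ring
  | mul_X p k hp =>
    have hk : (X i - X (i + 1) : MvPolynomial ℕ ℤ) ∣ X k - X (Equiv.swap i (i + 1) k) := by
      by_cases h1 : k = i
      · subst h1; simp
      · by_cases h2 : k = i + 1
        · subst h2
          rw [Equiv.swap_apply_right]
          exact ⟨-1, by ring⟩
        · rw [Equiv.swap_apply_of_ne_of_ne h1 h2]; simp
    have h := dvd_add (hp.mul_right (X k))
      (hk.mul_left (rename (Equiv.swap i (i + 1)) p))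
    rw [map_mul, rename_X]
    convert h using 1
    ring

/-- The divided difference operator `∂_i f = (f - s_i f) / (x_i - x_{i+1})`: the (unique) quotient
of this exact division. -/
def divDiff (i : ℕ) (f : MvPolynomial ℕ ℤ) : MvPolynomial ℕ ℤ :=
  (dvd_sub_swapVars i f).choose

theorem divDiff_spec (i : ℕ) (f : MvPolynomial ℕ ℤ) :
    f - swapVars i f = (X i - X (i + 1)) * divDiff i f :=
  (dvd_sub_swapVars i f).choose_spec

theorem divDiff_unique (i : ℕ) (f g : MvPolynomial ℕ ℤ)
    (h : f - swapVars i f = (X i - X (i + 1)) * g) : divDiff i f = g := by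
  have hne : (X i - X (i + 1) : MvPolynomial ℕ ℤ) ≠ 0 := by
    rw [sub_ne_zero]
    intro h
    have := X_injective h
    omega
  exact mul_left_cancel₀ hne ((divDiff_spec i f).symm.trans h)

/-- `w` has an ascent at position `i`, that is, `w(i) < w(i+1)`. -/
def IsAscent {n : ℕ} (w : Equiv.Perm (Fin n)) (i : ℕ) : Prop :=
  ∃ h : i + 1 < n, w ⟨i, Nat.lt_of_succ_lt h⟩ < w ⟨i + 1, h⟩

/-- `w s_i`, that is, `w` with the values `w(i)` and `w(i+1)` interchanged. -/
def mulSimple {n : ℕ} (w : Equiv.Perm (Fin n)) (i : ℕ) (h : i + 1 < n) : Equiv.Perm (Fin n) :=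
  w * Equiv.swap ⟨i, Nat.lt_of_succ_lt h⟩ ⟨i + 1, h⟩

/-- A quantity that decreases from `w` to `w s_i` at an ascent `i`; it is used only to show that
the recursion for Schubert polynomials terminates. -/
def potential {n : ℕ} (w : Equiv.Perm (Fin n)) : ℕ :=
  ∑ k : Fin n, (k : ℕ) * (w k : ℕ)

theorem potential_mulSimple_lt {n : ℕ} (w : Equiv.Perm (Fin n)) (i : ℕ) (h : IsAscent w i) :
    potential (mulSimple w i h.1) < potential w := by
  obtain ⟨hi, hw⟩ := h
  set a : Fin n := ⟨i, Nat.lt_of_succ_lt hi⟩ with ha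
  set b : Fin n := ⟨i + 1, hi⟩ with hb
  have hab : a ≠ b := by simp [ha, hb]
  have key : ∀ v : Equiv.Perm (Fin n), potential v =
      (a : ℕ) * (v a : ℕ) + ((b : ℕ) * (v b : ℕ) +
        ∑ k ∈ (Finset.univ.erase a).erase b, (k : ℕ) * (v k : ℕ)) := by
    intro v
    unfold potential
    rw [Finset.add_sum_erase (Finset.univ.erase a) (fun k : Fin n => (k : ℕ) * (v k : ℕ))
        (by simp [hab.symm]),
      Finset.add_sum_erase Finset.univ (fun k : Fin n => (k : ℕ) * (v k : ℕ)) (by simp)]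
  rw [key, key w]
  have h3 : ∑ k ∈ (Finset.univ.erase a).erase b, (k : ℕ) * (mulSimple w i hi k : ℕ) =
      ∑ k ∈ (Finset.univ.erase a).erase b, (k : ℕ) * (w k : ℕ) := by
    refine Finset.sum_congr rfl fun k hk => ?_
    simp only [Finset.mem_erase, Finset.mem_univ, and_true] at hk
    simp only [mulSimple, Equiv.Perm.mul_apply]
    rw [Equiv.swap_apply_of_ne_of_ne hk.2 hk.1]
  rw [h3]
  have e1 : mulSimple w i hi a = w b := by simp [mulSimple, ha, hb]
  have e2 : mulSimple w i hi b = w a := by simp [mulSimple, ha, hb]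
  rw [e1, e2]
  have h4 : (w a : ℕ) < (w b : ℕ) := hw
  have h5 : (a : ℕ) = i := rfl
  have h6 : (b : ℕ) = i + 1 := rfl
  rw [h5, h6]
  nlinarith

open Classical in
/-- The Schubert polynomial of `w ∈ S_n`. If `w` has an ascent, then it is `∂_i` of the Schubert
polynomial of `w s_i` for an ascent `i` of `w`; the result does not depend on the ascent, and
the first one is taken. The only permutation without an ascent is the longest one, whose Schubert
polynomial is `x_1^{n-1} x_2^{n-2} ⋯ x_{n-1}`. -/
def schubert {n : ℕ} (w : Equiv.Perm (Fin n)) : MvPolynomial ℕ ℤ :=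
  if h : ∃ i, IsAscent w i then
    divDiff (Nat.find h) (schubert (mulSimple w (Nat.find h) (Nat.find_spec h).1))
  else
    ∏ i ∈ Finset.range n, X i ^ (n - 1 - i)
termination_by potential w
decreasing_by exact potential_mulSimple_lt w _ (Nat.find_spec h)

/-- The principal specialization `Υ_w`: the Schubert polynomial of `w` at `x_i = 1`. -/
def upsilon {n : ℕ} (w : Equiv.Perm (Fin n)) : ℤ :=
  eval (fun _ => 1) (schubert w)

/-! ### Words, subwords and patterns

Words of positive integers are lists of natural numbers, and `u ≤ v` (`u` is a subword of `v`) is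
`List.Sublist u v`. -/

/-- The one-line notation `w(1) w(2) ⋯ w(n)` of a permutation, with values in `{1, …, n}`. -/
def oneLine {n : ℕ} (w : Equiv.Perm (Fin n)) : List ℕ :=
  List.ofFn fun i => (w i : ℕ) + 1

/-- `perm(u)`: the permutation with the same relative order as the word `u`
(see `wordPerm_lt_iff`). -/
def wordPerm (u : List ℕ) : Equiv.Perm (Fin u.length) :=
  (Tuple.sort u.get)⁻¹

theorem wordPerm_lt_iff (u : List ℕ) (hu : u.Nodup) (i j : Fin u.length) :
    wordPerm u i < wordPerm u j ↔ u.get i < u.get j := by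
  have hinj : Function.Injective u.get := List.nodup_iff_injective_get.1 hu
  have hm : StrictMono (u.get ∘ Tuple.sort u.get) :=
    (Tuple.monotone_sort u.get).strictMono_of_injective
      (hinj.comp (Tuple.sort u.get).injective)
  have h := hm.lt_iff_lt (a := wordPerm u i) (b := wordPerm u j)
  rw [← h]
  simp [wordPerm]

/-- The finite set of words `v` with `u ≤ v ≤ w`. -/
def wordsBetween (u w : List ℕ) : Finset (List ℕ) :=
  w.sublists.toFinset.filter fun v => List.Sublist u v

theorem mem_wordsBetween (u v w : List ℕ) :
    v ∈ wordsBetween u w ↔ List.Sublist u v ∧ List.Sublist v w := by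
  simp [wordsBetween, and_comm]

/-- `p_u(w)`: the number of subwords `v` of `w` with `perm(v) = u` (as words). -/
def patternCount {m n : ℕ} (u : Equiv.Perm (Fin m)) (w : Equiv.Perm (Fin n)) : ℕ :=
  ((wordsBetween [] (oneLine w)).filter fun v => oneLine (wordPerm v) = oneLine u).card

/-- `w` does not contain the pattern `1423`. -/
def Avoids1423 {n : ℕ} (w : Equiv.Perm (Fin n)) : Prop :=
  ∀ v : List ℕ, List.Sublist v (oneLine w) → oneLine (wordPerm v) ≠ [1, 4, 2, 3]

/-- The numbers `c_w`: `c_∅ = 1`, and `c_w = Υ_w - ∑ c_v p_v(w)` for `w ∈ S_n` with `n ≥ 1`, where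
the sum is over `v ∈ S_m` with `0 ≤ m < n`. -/
def coeffC : {n : ℕ} → Equiv.Perm (Fin n) → ℤ
  | 0, _ => 1
  | n + 1, w =>
    upsilon w - ∑ m : Fin (n + 1), ∑ v : Equiv.Perm (Fin m), coeffC v * (patternCount v w : ℤ)
termination_by n => n
decreasing_by exact m.isLt

end SchubertSpec

end

/-! The Fomin-Kirillov product of factors `1 + x u_i`, with the nilCoxeter generators acting on
functions of words, computes Schubert polynomials (`schubert_eq_wordSchubert`), so Υ makes sense for
every word of distinct letters. At `x_i = 1` the first column of the product splits off, which
yields a recursion deleting the smallest letter μ (`wordUpsilon_append_cons`): Υ(AμB) is the sum of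
Υ(Ar) over the outcomes r of passing through B from right to left and removing some of the descents
met.

The heart is `wordUpsilon_res_mem_totallyMonotone`: if W avoids 1423, then T ↦ Υ(W|T), where W|T is
the subword of letters in T, is a nonnegative combination of indicators [S ⊆ T]. Möbius inversion
identifies the coefficient of S with c of perm(W|S) (`coeffC_wordPerm_res`), which gives (2). An
alternating sum of [S ⊆ T] over an interval is 0 or 1 (`sum_Icc_nonneg`), which gives (1).

Total monotonicity is proved by induction on the length. Jumps can create occurrences of 1423, but
only ones whose letter 2 has itself jumped and so must lie in T. The induction therefore carries a
set F of marked letters containing the 2 of every 1423, and the function is multiplied by [F ⊆ T].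
The danger is that deleting a small letter a unblocks a letter m, which then jumps over a larger c
further left. But then c a m is a 312 to the right of μ, so μ c a m is a 1423 and a is marked: it
cannot be deleted. -/

namespace SchubertWords

/-! ### The nilCoxeter algebra acting on functions of words -/

section Operators

variable {R : Type*} [CommRing R]

/-- The right action of a nilCoxeter generator on functions of words, before linearity. -/
def descAux : ℕ → (List ℕ → R) → List ℕ → R
  | 0, F, a :: b :: l => if b < a then F (b :: a :: l) else 0
  | i + 1, F, a :: l => descAux i (fun r => F (a :: r)) l
  | 0, _, [] => 0
  | 0, _, [_] => 0
  | _ + 1, _, [] => 0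

theorem descAux_add (i : ℕ) (F G : List ℕ → R) (l : List ℕ) :
    descAux i (F + G) l = descAux i F l + descAux i G l := by
  induction i generalizing F G l with
  | zero =>
    rcases l with _ | ⟨a, _ | ⟨b, l⟩⟩
    · simp [descAux]
    · simp [descAux]
    · simp only [descAux, Pi.add_apply]; split_ifs <;> simp
  | succ i ih =>
    rcases l with _ | ⟨a, l⟩
    · simp [descAux]
    · exact ih _ _ _

theorem descAux_smul (i : ℕ) (c : R) (F : List ℕ → R) (l : List ℕ) :
    descAux i (c • F) l = c * descAux i F l := by
  induction i generalizing F l with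
  | zero =>
    rcases l with _ | ⟨a, _ | ⟨b, l⟩⟩
    · simp [descAux]
    · simp [descAux]
    · simp only [descAux, Pi.smul_apply, smul_eq_mul]; split_ifs <;> simp
  | succ i ih =>
    rcases l with _ | ⟨a, l⟩
    · simp [descAux]
    · exact ih _ _

/-- The nilCoxeter generator `u_i` acting on functions of words: the value of `desc i F` at a word
with a descent at `i` is the value of `F` at the word with that descent removed. -/
def desc (R : Type*) [CommRing R] (i : ℕ) : Module.End R (List ℕ → R) where
  toFun F := descAux i F
  map_add' F G := funext fun l => descAux_add i F G l
  map_smul' c F := funext fun l => descAux_smul i c F l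

theorem desc_zero_cons_cons (F : List ℕ → R) (a b : ℕ) (l : List ℕ) :
    desc R 0 F (a :: b :: l) = if b < a then F (b :: a :: l) else 0 := rfl

theorem desc_zero_singleton (F : List ℕ → R) (a : ℕ) : desc R 0 F [a] = 0 := rfl

theorem desc_nil (i : ℕ) (F : List ℕ → R) : desc R i F [] = 0 := by cases i <;> rfl

theorem desc_succ_cons (i : ℕ) (F : List ℕ → R) (a : ℕ) (l : List ℕ) :
    desc R (i + 1) F (a :: l) = desc R i (fun r => F (a :: r)) l := rfl

theorem desc_succ_comp_cons (i : ℕ) (F : List ℕ → R) (a : ℕ) :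
    (fun r => desc R (i + 1) F (a :: r)) = desc R i (fun r => F (a :: r)) := rfl

theorem desc_mul_self (i : ℕ) : desc R i * desc R i = 0 := by
  ext F l
  simp only [Module.End.mul_apply, LinearMap.zero_apply, Pi.zero_apply]
  induction i generalizing F l with
  | zero =>
    rcases l with _ | ⟨a, _ | ⟨b, l⟩⟩
    · rfl
    · rfl
    · simp only [desc_zero_cons_cons]
      split_ifs <;> first | omega | rfl
  | succ i ih =>
    rcases l with _ | ⟨a, l⟩
    · rfl
    · rw [desc_succ_cons, desc_succ_comp_cons]; exact ih _ _

theorem desc_comm (i k : ℕ) : desc R i * desc R (i + k + 2) = desc R (i + k + 2) * desc R i := by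
  ext F l
  simp only [Module.End.mul_apply]
  induction i generalizing F l with
  | zero =>
    rcases l with _ | ⟨a, _ | ⟨b, l⟩⟩
    · rfl
    · rw [desc_zero_singleton, zero_add, desc_succ_cons, desc_nil]
    · simp only [zero_add, desc_zero_cons_cons, desc_succ_cons]
      split_ifs with h
      · rfl
      · exact (congrFun (map_zero (desc R k)) l).symm
  | succ i ih =>
    rcases l with _ | ⟨a, l⟩
    · simp [desc_nil]
    · have e : i + 1 + k + 2 = (i + k + 2) + 1 := by omega
      rw [e, desc_succ_cons, desc_succ_cons, desc_succ_comp_cons, desc_succ_comp_cons]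
      exact ih _ _

theorem desc_braid (i : ℕ) :
    desc R i * desc R (i + 1) * desc R i = desc R (i + 1) * desc R i * desc R (i + 1) := by
  ext F l
  simp only [Module.End.mul_apply]
  induction i generalizing F l with
  | zero =>
    rcases l with _ | ⟨a, _ | ⟨b, _ | ⟨c, l⟩⟩⟩
    · rfl
    · rfl
    · simp [desc_zero_cons_cons, desc_succ_cons, desc_zero_singleton]
    · simp only [desc_zero_cons_cons, desc_succ_cons, zero_add]
      split_ifs <;> first | omega | rfl
  | succ i ih =>
    rcases l with _ | ⟨a, l⟩
    · simp [desc_nil]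
    · rw [desc_succ_cons, desc_succ_cons, desc_succ_comp_cons, desc_succ_comp_cons,
        desc_succ_comp_cons, desc_succ_comp_cons]
      exact ih _ _

/-- `1 + x u_i`. -/
def factor (x : R) (i : ℕ) : Module.End R (List ℕ → R) := 1 + x • desc R i

theorem factor_apply (x : R) (i : ℕ) (F : List ℕ → R) (l : List ℕ) :
    factor x i F l = F l + x * desc R i F l := rfl

theorem factor_comm (x y : R) (i k : ℕ) :
    factor x i * factor y (i + k + 2) = factor y (i + k + 2) * factor x i := by
  simp only [factor, mul_add, add_mul, mul_one, one_mul, smul_mul_assoc, mul_smul_comm,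
    desc_comm]
  module

theorem factor_neg_mul (x : R) (i : ℕ) : factor (-x) i * factor x i = 1 := by
  simp only [factor, mul_add, add_mul, mul_one, one_mul, smul_mul_assoc, mul_smul_comm,
    desc_mul_self]
  module

theorem desc_mul_factor (x : R) (i : ℕ) : desc R i * factor x i = desc R i := by
  simp [factor, mul_add, desc_mul_self]

/-- A consequence of the Yang-Baxter relation. -/
theorem factor_exchange (x y : R) (i : ℕ) :
    factor x i * factor x (i + 1) * factor y i * factor (-x) (i + 1) =
      1 + (x + y) • desc R i
        + (x * y) • (desc R (i + 1) * desc R i - desc R i * desc R (i + 1)) := by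
  have h1 := desc_mul_self (R := R) i
  have h2 := desc_mul_self (R := R) (i + 1)
  have h3 := desc_braid (R := R) i
  simp only [factor]
  generalize desc R i = a at *
  generalize desc R (i + 1) = b at *
  have h4 : b * a * b = a * b * a := h3.symm
  have h5 : a * b * a * b = 0 := by rw [h3, mul_assoc, h2, mul_zero]
  have h6 : a * b * b = 0 := by rw [mul_assoc, h2, mul_zero]
  simp only [mul_add, add_mul, mul_one, one_mul, smul_mul_assoc, mul_smul_comm, h1, h2, h4, h5,
    h6, smul_zero, zero_mul]
  module

/-- `(1 + x u_i)(1 + x u_{i+1}) ⋯ (1 + x u_{i+k-1})`. -/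
def arow (x : R) : ℕ → ℕ → Module.End R (List ℕ → R)
  | _, 0 => 1
  | i, k + 1 => factor x i * arow x (i + 1) k

theorem factor_comm_arow (x y : R) (i j k : ℕ) :
    factor x i * arow y (i + j + 2) k = arow y (i + j + 2) k * factor x i := by
  induction k generalizing j with
  | zero => simp [arow]
  | succ k ih =>
    rw [arow, ← mul_assoc, factor_comm, mul_assoc]
    have := ih (j + 1)
    rw [show i + (j + 1) + 2 = i + j + 2 + 1 by omega] at this
    rw [this, mul_assoc]

theorem arow_eq_neg_mul (x : R) (i k : ℕ) :
    arow x (i + 1) k = factor (-x) i * arow x i (k + 1) := by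
  rw [arow, ← mul_assoc, factor_neg_mul, one_mul]

/-- Induction on the length: the product of two rows is a four-factor expression, symmetric in `x`
and `y` by `factor_exchange`, times the product of the two rows without their first factors. -/
theorem arow_comm (x y : R) (i k : ℕ) : arow x i k * arow y i k = arow y i k * arow x i k := by
  induction k generalizing i with
  | zero => rfl
  | succ k ih =>
    rcases k with _ | k
    · simp only [arow, mul_one, factor, mul_add, add_mul, one_mul, smul_mul_assoc,
        mul_smul_comm, desc_mul_self]
      module
    · have key : ∀ x y : R, arow x i (k + 1 + 1) * arow y i (k + 1 + 1) =
          (factor x i * factor x (i + 1) * factor y i * factor (-x) (i + 1)) *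
            (arow x (i + 1) (k + 1) * arow y (i + 1) (k + 1)) := by
        intro x y
        rw [arow, arow, arow.eq_2 y i]
        have h := factor_comm_arow y x i 0 k
        rw [show i + 0 + 2 = i + 1 + 1 by omega] at h
        calc factor x i * (factor x (i + 1) * arow x (i + 1 + 1) k) *
              (factor y i * arow y (i + 1) (k + 1))
            = factor x i * factor x (i + 1) * (arow x (i + 1 + 1) k * factor y i) *
              arow y (i + 1) (k + 1) := by simp only [mul_assoc]
          _ = factor x i * factor x (i + 1) * (factor y i * arow x (i + 1 + 1) k) *
              arow y (i + 1) (k + 1) := by rw [h]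
          _ = factor x i * factor x (i + 1) * factor y i * arow x (i + 1 + 1) k *
              arow y (i + 1) (k + 1) := by simp only [mul_assoc]
          _ = _ := by
              simp only [mul_assoc]
              -- The inserted factor with `-x` cancels the first factor of the shorter row in `x`.
              rw [← mul_assoc (factor (-x) (i + 1)) (factor x (i + 1)), factor_neg_mul, one_mul]
      rw [key, key, ih, factor_exchange, factor_exchange, add_comm x y, mul_comm x y]

/-- The product of `arow (x j) j (i + k - j)` for `j` from `i + k - 1` down to `i`. -/
def rows (x : ℕ → R) : ℕ → ℕ → Module.End R (List ℕ → R)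
  | _, 0 => 1
  | i, k + 1 => rows x (i + 1) k * arow (x i) i (k + 1)

theorem rows_eq (x : ℕ → R) (i k : ℕ) :
    rows x i k = rows x (i + 1) (k - 1) * arow (x i) i k := by
  cases k <;> simp [rows, arow]

theorem factor_comm_rows (y : R) (x : ℕ → R) (i j k : ℕ) :
    factor y i * rows x (i + j + 2) k = rows x (i + j + 2) k * factor y i := by
  induction k generalizing j with
  | zero => simp [rows]
  | succ k ih =>
    have h := ih (j + 1)
    rw [show i + (j + 1) + 2 = i + j + 2 + 1 by omega] at h
    rw [rows, ← mul_assoc, h, mul_assoc, factor_comm_arow, mul_assoc]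

theorem rows_congr {x y : ℕ → R} {i : ℕ} (h : ∀ j, i ≤ j → x j = y j) (k : ℕ) :
    rows x i k = rows y i k := by
  induction k generalizing i with
  | zero => rfl
  | succ k ih => rw [rows, rows, ih fun j hj => h j (by omega), h i le_rfl]

/-- Lengthening the second row to start at `i` makes the last two rows commute. The bracket is then
symmetric in `x i` and `x (i + 1)`, and all asymmetry sits in the single factor in front. -/
theorem rows_succ_eq_neg_mul (x : ℕ → R) (i k : ℕ) :
    rows x i (k + 1) = factor (-x (i + 1)) i *
      (rows x (i + 2) (k - 1) * (arow (x (i + 1)) i (k + 1) * arow (x i) i (k + 1))) := by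
  have h := factor_comm_rows (-x (i + 1)) x i 0 (k - 1)
  rw [add_zero] at h
  rw [rows, rows_eq, arow_eq_neg_mul, ← mul_assoc (factor _ _), h]
  simp only [mul_assoc]

/-! ### Change of coefficients -/

section Map

variable {R' : Type*} [CommRing R'] (σ : R →+* R')

theorem map_desc (i : ℕ) (F : List ℕ → R) (l : List ℕ) :
    σ (desc R i F l) = desc R' i (fun r => σ (F r)) l := by
  induction i generalizing F l with
  | zero =>
    rcases l with _ | ⟨a, _ | ⟨b, l⟩⟩
    · simp [desc_nil]
    · simp [desc_zero_singleton]
    · simp only [desc_zero_cons_cons]; split_ifs <;> simp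
  | succ i ih =>
    rcases l with _ | ⟨a, l⟩
    · simp [desc_nil]
    · exact ih _ _

theorem map_factor (x : R) (i : ℕ) (F : List ℕ → R) (l : List ℕ) :
    σ (factor x i F l) = factor (σ x) i (fun r => σ (F r)) l := by
  simp [factor_apply, map_desc]

theorem map_arow (x : R) (i k : ℕ) (F : List ℕ → R) (l : List ℕ) :
    σ (arow x i k F l) = arow (σ x) i k (fun r => σ (F r)) l := by
  induction k generalizing i l with
  | zero => rfl
  | succ k ih =>
    simp only [arow, Module.End.mul_apply, map_factor]
    exact congrArg (fun H => factor (σ x) i H l) (funext fun r => ih _ _)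

theorem map_rows (x : ℕ → R) (i k : ℕ) (F : List ℕ → R) (l : List ℕ) :
    σ (rows x i k F l) = rows (fun j => σ (x j)) i k (fun r => σ (F r)) l := by
  induction k generalizing i F l with
  | zero => rfl
  | succ k ih =>
    simp only [rows, Module.End.mul_apply, ih]
    exact congrArg (fun H => rows (fun j => σ (x j)) (i + 1) k H l)
      (funext fun r => map_arow σ _ _ _ _ _)

end Map

/-! ### Shifting and relabelling -/

theorem factor_succ_cons (x : R) (i : ℕ) (F : List ℕ → R) (a : ℕ) (l : List ℕ) :
    factor x (i + 1) F (a :: l) = factor x i (fun r => F (a :: r)) l := rfl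

theorem arow_succ_cons (x : R) (i k : ℕ) (F : List ℕ → R) (a : ℕ) (l : List ℕ) :
    arow x (i + 1) k F (a :: l) = arow x i k (fun r => F (a :: r)) l := by
  induction k generalizing i l with
  | zero => rfl
  | succ k ih =>
    simp only [arow, Module.End.mul_apply, factor_succ_cons]
    exact congrArg (fun H => factor x i H l) (funext fun r => ih _ _)

theorem rows_succ_cons (x : ℕ → R) (i k : ℕ) (F : List ℕ → R) (a : ℕ) (l : List ℕ) :
    rows x (i + 1) k F (a :: l) = rows (fun j => x (j + 1)) i k (fun r => F (a :: r)) l := by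
  induction k generalizing i F l with
  | zero => rfl
  | succ k ih =>
    simp only [rows, Module.End.mul_apply, ih]
    exact congrArg (fun H => rows (fun j => x (j + 1)) (i + 1) k H l)
      (funext fun r => arow_succ_cons _ _ _ _ _ _)

/-- The operators only compare and permute letters, so they commute with increasing relabellings and
see a function only on rearrangements of the given word. -/
theorem desc_map {f : ℕ → ℕ} (i : ℕ) {F G : List ℕ → R} {l : List ℕ}
    (hf : StrictMonoOn f {x | x ∈ l}) (h : ∀ r : List ℕ, r.Perm l → F (r.map f) = G r) :
    desc R i F (l.map f) = desc R i G l := by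
  induction i generalizing F G l with
  | zero =>
    rcases l with _ | ⟨a, _ | ⟨b, l⟩⟩
    · simp [desc_nil]
    · simp [desc_zero_singleton]
    · have e : f b < f a ↔ b < a := hf.lt_iff_lt (by simp) (by simp)
      simp only [List.map_cons, desc_zero_cons_cons, e]
      split_ifs
      · exact h (b :: a :: l) (List.Perm.swap _ _ _)
      · rfl
  | succ i ih =>
    rcases l with _ | ⟨a, l⟩
    · simp [desc_nil]
    · exact ih (hf.mono fun x hx => List.mem_cons_of_mem _ hx) fun r hr => h (a :: r) (hr.cons a)

theorem factor_map {f : ℕ → ℕ} (x : R) (i : ℕ) {F G : List ℕ → R} {l : List ℕ}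
    (hf : StrictMonoOn f {x | x ∈ l}) (h : ∀ r : List ℕ, r.Perm l → F (r.map f) = G r) :
    factor x i F (l.map f) = factor x i G l := by
  rw [factor_apply, factor_apply, desc_map i hf h, h l (List.Perm.refl l)]

theorem arow_map {f : ℕ → ℕ} (x : R) (i k : ℕ) {F G : List ℕ → R} {l : List ℕ}
    (hf : StrictMonoOn f {x | x ∈ l}) (h : ∀ r : List ℕ, r.Perm l → F (r.map f) = G r) :
    arow x i k F (l.map f) = arow x i k G l := by
  induction k generalizing i l with
  | zero => exact h l (List.Perm.refl l)
  | succ k ih =>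
    exact factor_map x i hf fun r hr =>
      ih _ (hf.mono fun x hx => hr.mem_iff.1 hx) fun s hs => h s (hs.trans hr)

theorem rows_map {f : ℕ → ℕ} (x : ℕ → R) (i k : ℕ) {F G : List ℕ → R} {l : List ℕ}
    (hf : StrictMonoOn f {x | x ∈ l}) (h : ∀ r : List ℕ, r.Perm l → F (r.map f) = G r) :
    rows x i k F (l.map f) = rows x i k G l := by
  induction k generalizing i F G with
  | zero => exact h l (List.Perm.refl l)
  | succ k ih =>
    exact ih _ fun r hr => arow_map _ _ _ (hf.mono fun x hx => hr.mem_iff.1 hx)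
      fun s hs => h s (hs.trans hr)

theorem arow_local (x : R) (i k : ℕ) {F G : List ℕ → R} {l : List ℕ}
    (h : ∀ r : List ℕ, r.Perm l → F r = G r) : arow x i k F l = arow x i k G l := by
  simpa using arow_map (f := id) x i k (strictMono_id.strictMonoOn _) (by simpa using h)

theorem rows_local (x : ℕ → R) (i k : ℕ) {F G : List ℕ → R} {l : List ℕ}
    (h : ∀ r : List ℕ, r.Perm l → F r = G r) : rows x i k F l = rows x i k G l := by
  simpa using rows_map (f := id) x i k (strictMono_id.strictMonoOn _) (by simpa using h)

theorem desc_append (i : ℕ) (F : List ℕ → R) (p : List ℕ) (hp : p.length = i) (a b : ℕ)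
    (q : List ℕ) :
    desc R i F (p ++ a :: b :: q) = if b < a then F (p ++ b :: a :: q) else 0 := by
  subst hp
  induction p generalizing F with
  | nil => rfl
  | cons c p ih => exact ih _

/-! ### Decreasing words and the staircase monomial -/

/-- The indicator function of increasing words. -/
def sortedInd (R : Type*) [CommRing R] (l : List ℕ) : R := if l.Pairwise (· < ·) then 1 else 0

theorem sortedInd_cons (a : ℕ) (l : List ℕ) :
    sortedInd R (a :: l) = if ∀ x ∈ l, a < x then sortedInd R l else 0 := by
  simp only [sortedInd, List.pairwise_cons]
  split_ifs <;> simp_all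

theorem map_sortedInd {R' : Type*} [CommRing R'] (σ : R →+* R') (l : List ℕ) :
    σ (sortedInd R l) = sortedInd R' l := by
  simp only [sortedInd]; split_ifs <;> simp

/-- Since `F` kills words in which `c` precedes a smaller letter, only the term carrying `c` all the
way to the end survives, with one factor `x` per step. -/
theorem arow_zero_cons_of_max (x : R) (c : ℕ) {F : List ℕ → R}
    (hF : ∀ (p : List ℕ) (b : ℕ) (q : List ℕ), b < c → F (p ++ c :: b :: q) = 0)
    (r : List ℕ) (hr : ∀ b ∈ r, b < c) :
    arow x 0 r.length F (c :: r) = x ^ r.length * F (r ++ [c]) := by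
  induction r generalizing F with
  | nil => simp [arow]
  | cons b r ih =>
    -- If the first descent is kept, the remaining factors leave `c` in front of a smaller letter.
    have h1 : arow x 1 r.length F (c :: b :: r) = 0 := by
      rw [arow_succ_cons]
      have : arow x 0 r.length (fun s => F (c :: s)) (b :: r) =
          arow x 0 r.length (0 : List ℕ → R) (b :: r) := by
        refine arow_local x 0 _ fun s hs => ?_
        rcases s with _ | ⟨d, s⟩
        · simpa using hs.length_eq
        · exact hF [] d s (hr d (hs.mem_iff.1 (by simp)))
      rw [this, map_zero]; rfl
    have hb : b < c := hr b (by simp)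
    rw [List.length_cons, arow, Module.End.mul_apply, factor_apply, desc_zero_cons_cons,
      if_pos hb, zero_add, h1, arow_succ_cons,
      ih (fun p b' q h => hF (b :: p) b' q h) fun d hd => hr d (List.mem_cons_of_mem _ hd)]
    simp only [List.cons_append]
    ring

theorem rows_sortedInd_of_decreasing (x : ℕ → R) (l : List ℕ) (hl : l.Pairwise (· > ·)) :
    rows x 0 (l.length - 1) (sortedInd R) l =
      ∏ i ∈ Finset.range l.length, x i ^ (l.length - 1 - i) := by
  induction l generalizing x with
  | nil => simp [rows, sortedInd]
  | cons c l ih =>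
    rw [List.pairwise_cons] at hl
    rcases l with _ | ⟨d, l⟩
    · simp [rows, sortedInd]
    · set m := d :: l with hm
      have e : (c :: m).length - 1 = l.length + 1 := by simp [hm]
      rw [e, rows, Module.End.mul_apply, rows_succ_cons]
      have key : ∀ r : List ℕ, r.Perm m → arow (x 0) 0 (l.length + 1) (sortedInd R) (c :: r) =
          (x 0 ^ (l.length + 1) • sortedInd R : List ℕ → R) r := by
        intro r hr
        have hlen : r.length = l.length + 1 := by rw [hr.length_eq, hm]; rfl
        have hlt : ∀ b ∈ r, b < c := fun b hb => hl.1 b (hr.mem_iff.1 hb)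
        rw [← hlen, arow_zero_cons_of_max (x 0) c _ r hlt]
        · simp only [Pi.smul_apply, smul_eq_mul, sortedInd, List.pairwise_append]
          congr 2
          simp only [List.pairwise_singleton, List.mem_singleton, true_and, forall_eq,
            eq_iff_iff, and_iff_left_iff_imp]
          exact fun _ => hlt
        · intro p b q hb
          rw [sortedInd, if_neg]
          simp only [List.pairwise_append, List.pairwise_cons]
          rintro ⟨-, ⟨h, -⟩, -⟩
          have := h b (by simp)
          omega
      rw [rows_local _ _ _ key, map_smul, Pi.smul_apply, smul_eq_mul]
      have := ih (fun j => x (j + 1)) hl.2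
      rw [show m.length - 1 = l.length by simp [hm]] at this
      have e' : m.length = l.length + 1 := by simp [hm]
      have e2 : (c :: m).length = l.length + 1 + 1 := by simp [hm]
      rw [this, e', e2, Finset.prod_range_succ' _ (l.length + 1), mul_comm]
      refine congrArg (· * x 0 ^ (l.length + 1)) (Finset.prod_congr rfl fun i _ => ?_)
      congr 1
      omega

end Operators

/-! ### Schubert polynomials as sums over words -/

open MvPolynomial SchubertSpec

/-- The Schubert polynomial of a word, by the Fomin-Kirillov product formula. -/
noncomputable def wordSchubert (l : List ℕ) : MvPolynomial ℕ ℤ :=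
  rows (fun i => X i) 0 (l.length - 1) (sortedInd _) l

/-- Write the product as `(1 - x_{i+1} u_i) G` with `G` symmetric in `x_i` and `x_{i+1}`. Then `f -
s_i f = (x_i - x_{i+1}) u_i G`, and `u_i f = u_i G` because `u_i² = 0`. The rows before row `i` do
not involve these two variables and are absorbed into `F`; `d` counts them. -/
theorem rows_sub_swapVars (i k d j : ℕ) (hj : j + d = i) (F : List ℕ → MvPolynomial ℕ ℤ)
    (hF : ∀ l, swapVars i (F l) = F l) (l : List ℕ) :
    rows (fun i => X i) j (d + k + 1) F l - swapVars i (rows (fun i => X i) j (d + k + 1) F l) =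
      (X i - X (i + 1)) *
        desc (MvPolynomial ℕ ℤ) i (rows (fun i => X i) j (d + k + 1) F) l := by
  induction d generalizing j F with
  | zero =>
    obtain rfl : j = i := by omega
    set σ : MvPolynomial ℕ ℤ →+* MvPolynomial ℕ ℤ :=
      (rename (Equiv.swap j (j + 1)) : MvPolynomial ℕ ℤ →ₐ[ℤ] MvPolynomial ℕ ℤ).toRingHom with hσ
    have hs : ∀ f, swapVars j f = σ f := fun f => rfl
    have hX : ∀ t, σ (X t) = X (Equiv.swap j (j + 1) t) := fun t => rename_X _ _
    rw [zero_add, rows_succ_eq_neg_mul]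
    set G : List ℕ → MvPolynomial ℕ ℤ := ((rows (fun i => X i : ℕ → MvPolynomial ℕ ℤ) (j + 2) (k - 1) *
      (arow (X (j + 1)) j (k + 1) * arow (X j) j (k + 1)) :
        Module.End (MvPolynomial ℕ ℤ) (List ℕ → MvPolynomial ℕ ℤ))) F with hG
    have hGσ : ∀ r, σ (G r) = G r := by
      intro r
      rw [hG]
      -- The substitution exchanges the parameters of the two long rows, so commuting them restores
      -- the original order.
      conv_rhs => rw [arow_comm]
      simp only [Module.End.mul_apply]
      rw [map_rows, rows_congr (y := fun i => X i)]
      · refine congrArg (fun H => rows (fun i => X i) (j + 2) (k - 1) H r) (funext fun s => ?_)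
        rw [map_arow, hX, Equiv.swap_apply_right]
        refine congrArg (fun H => arow (X j) j (k + 1) H s) (funext fun t => ?_)
        rw [map_arow, hX, Equiv.swap_apply_left]
        exact congrArg (fun H => arow (X (j + 1)) j (k + 1) H t) (funext fun u => hF u)
      · intro t ht
        rw [hX, Equiv.swap_apply_of_ne_of_ne (by omega) (by omega)]
    have h1 : desc (MvPolynomial ℕ ℤ) j ((factor (-X (j + 1)) j * (rows (fun i => X i) (j + 2)
        (k - 1) * (arow (X (j + 1)) j (k + 1) * arow (X j) j (k + 1))) :
        Module.End (MvPolynomial ℕ ℤ) (List ℕ → MvPolynomial ℕ ℤ)) F) = desc _ j G := by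
      rw [Module.End.mul_apply, ← Module.End.mul_apply (desc _ j), desc_mul_factor]
    rw [h1, Module.End.mul_apply, ← hG, hs, map_factor]
    simp only [hGσ, factor_apply, map_neg, hX, Equiv.swap_apply_right]
    ring
  | succ d ih =>
    have e : d + 1 + k + 1 = (d + k + 1) + 1 := by omega
    rw [e, rows, Module.End.mul_apply]
    refine ih (j + 1) (by omega) _ fun r => ?_
    have := map_arow (rename (Equiv.swap i (i + 1)) :
      MvPolynomial ℕ ℤ →ₐ[ℤ] MvPolynomial ℕ ℤ).toRingHom (X j) j (d + k + 1 + 1) F r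
    refine this.trans ?_
    have hX : (rename (Equiv.swap i (i + 1)) :
      MvPolynomial ℕ ℤ →ₐ[ℤ] MvPolynomial ℕ ℤ).toRingHom (X j) = X j := by
      refine (rename_X _ _).trans ?_
      rw [Equiv.swap_apply_of_ne_of_ne (by omega) (by omega)]
    rw [hX]
    exact congrArg (fun H => arow (X j) j (d + k + 1 + 1) H r) (funext fun s => hF s)

theorem wordSchubert_sub_swapVars (p q : List ℕ) (a b : ℕ) (h : a < b) :
    divDiff p.length (wordSchubert (p ++ b :: a :: q)) = wordSchubert (p ++ a :: b :: q) := by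
  apply divDiff_unique
  have h1 := rows_sub_swapVars p.length q.length p.length 0 (by omega) (sortedInd _)
    (fun l => map_sortedInd (rename (Equiv.swap p.length (p.length + 1)) :
      MvPolynomial ℕ ℤ →ₐ[ℤ] MvPolynomial ℕ ℤ).toRingHom l) (p ++ b :: a :: q)
  rw [desc_append _ _ _ rfl, if_pos h] at h1
  have e1 : (p ++ b :: a :: q).length - 1 = p.length + q.length + 1 := by simp; omega
  have e2 : (p ++ a :: b :: q).length - 1 = p.length + q.length + 1 := by simp; omega
  rw [wordSchubert, wordSchubert, e1, e2]
  exact h1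

/-! ### Agreement with the recursive definition -/

theorem length_oneLine {n : ℕ} (w : Equiv.Perm (Fin n)) : (oneLine w).length = n := by
  simp [oneLine]

theorem oneLine_split {n : ℕ} (w : Equiv.Perm (Fin n)) (i : ℕ) (h : i + 1 < n) :
    ∃ p q : List ℕ, p.length = i ∧
      oneLine w = p ++ ((w ⟨i, by omega⟩ : ℕ) + 1) :: ((w ⟨i + 1, h⟩ : ℕ) + 1) :: q ∧
      oneLine (mulSimple w i h) =
        p ++ ((w ⟨i + 1, h⟩ : ℕ) + 1) :: ((w ⟨i, by omega⟩ : ℕ) + 1) :: q := by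
  have hsplit : ∀ l : List ℕ, ∀ hl : i + 1 < l.length,
      l = l.take i ++ l[i] :: l[i + 1] :: l.drop (i + 2) := by
    intro l hl
    rw [← List.drop_eq_getElem_cons hl, ← List.drop_eq_getElem_cons (by omega : i < l.length),
      List.take_append_drop]
  refine ⟨(oneLine w).take i, (oneLine w).drop (i + 2), ?_, ?_, ?_⟩
  · simp [length_oneLine]; omega
  · conv_lhs => rw [hsplit (oneLine w) (by rw [length_oneLine]; exact h)]
    simp [oneLine]
  · conv_lhs => rw [hsplit (oneLine (mulSimple w i h)) (by rw [length_oneLine]; exact h)]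
    have h1 : (oneLine (mulSimple w i h)).take i = (oneLine w).take i := by
      apply List.ext_getElem
      · simp [length_oneLine]
      · intro k hk _
        simp only [List.length_take] at hk
        simp only [oneLine, mulSimple, List.getElem_take, List.getElem_ofFn,
          Equiv.Perm.mul_apply]
        rw [Equiv.swap_apply_of_ne_of_ne] <;> simp [Fin.ext_iff] <;> omega
    have h2 : (oneLine (mulSimple w i h)).drop (i + 2) = (oneLine w).drop (i + 2) := by
      apply List.ext_getElem
      · simp [length_oneLine]
      · intro k hk _
        simp only [oneLine, mulSimple, List.getElem_drop, List.getElem_ofFn,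
          Equiv.Perm.mul_apply]
        rw [Equiv.swap_apply_of_ne_of_ne] <;> simp [Fin.ext_iff] <;> omega
    rw [h1, h2]
    simp [oneLine, mulSimple]

theorem schubert_eq_wordSchubert {n : ℕ} (w : Equiv.Perm (Fin n)) :
    schubert w = wordSchubert (oneLine w) := by
  induction hp : potential w using Nat.strong_induction_on generalizing w with
  | _ N ih =>
  subst hp
  rw [schubert]
  split_ifs with h
  · classical
    obtain ⟨hi, hlt⟩ := Nat.find_spec h
    rw [ih _ (potential_mulSimple_lt w _ (Nat.find_spec h)) _ rfl]
    obtain ⟨p, q, hp, e1, e2⟩ := oneLine_split w _ hi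
    rw [e1, e2]
    have := wordSchubert_sub_swapVars p q _ _ (Nat.succ_lt_succ (Fin.lt_def.1 hlt))
    rw [hp] at this
    exact this
  · have hl : (oneLine w).Pairwise (· > ·) := by
      rw [← List.isChain_iff_pairwise, List.isChain_iff_getElem]
      intro i hi
      rw [length_oneLine] at hi
      simp only [oneLine, List.getElem_ofFn, gt_iff_lt, add_lt_add_iff_right, Fin.val_fin_lt]
      have h1 : ¬ w ⟨i, by omega⟩ < w ⟨i + 1, hi⟩ := fun hlt => h ⟨i, hi, hlt⟩
      refine lt_of_le_of_ne (not_lt.1 h1) fun he => ?_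
      have := Fin.ext_iff.1 (w.injective he)
      simp at this
    have := rows_sortedInd_of_decreasing (fun i => (X i : MvPolynomial ℕ ℤ)) _ hl
    rw [wordSchubert, this, length_oneLine]

/-- The principal specialization of the Schubert polynomial of a word. -/
def wordUpsilon (l : List ℕ) : ℤ := rows (fun _ => (1 : ℤ)) 0 (l.length - 1) (sortedInd ℤ) l

theorem upsilon_eq_wordUpsilon {n : ℕ} (w : Equiv.Perm (Fin n)) :
    upsilon w = wordUpsilon (oneLine w) := by
  rw [upsilon, schubert_eq_wordSchubert, wordSchubert, map_rows, wordUpsilon]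
  simp only [eval_X, map_sortedInd]

theorem wordUpsilon_map {f : ℕ → ℕ} {l : List ℕ} (hf : StrictMonoOn f {x | x ∈ l}) :
    wordUpsilon (l.map f) = wordUpsilon l := by
  rw [wordUpsilon, List.length_map]
  refine rows_map _ _ _ hf fun r hr => ?_
  simp only [sortedInd, List.pairwise_map]
  refine if_congr ?_ rfl rfl
  exact List.Pairwise.iff_of_mem fun {a b} ha hb =>
    hf.lt_iff_lt (hr.mem_iff.1 ha) (hr.mem_iff.1 hb)

/-! ### Removing the smallest letter of a word -/

section Column

variable {R : Type*} [CommRing R]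

/-- `(1 + u_{i+k-1}) ⋯ (1 + u_i)`. -/
def col (R : Type*) [CommRing R] : ℕ → ℕ → Module.End R (List ℕ → R)
  | _, 0 => 1
  | i, k + 1 => col R (i + 1) k * factor 1 i

/-- Splitting off the first column instead of the first row. -/
theorem rows_one_eq_col_mul (i k : ℕ) :
    rows (fun _ => (1 : R)) i (k + 1) = col R i (k + 1) * rows (fun _ => 1) (i + 1) k := by
  induction k generalizing i with
  | zero => simp [rows, col, arow]
  | succ k ih =>
    have h := factor_comm_rows (1 : R) (fun _ => 1) i 0 k
    rw [add_zero] at h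
    calc rows (fun _ => (1 : R)) i (k + 1 + 1)
        = rows (fun _ => 1) (i + 1) (k + 1) * arow 1 i (k + 1 + 1) := rfl
      _ = col R (i + 1) (k + 1) * (rows (fun _ => 1) (i + 2) k * factor 1 i) *
            arow 1 (i + 1) (k + 1) := by
          rw [ih, arow]; simp only [mul_assoc]
      _ = col R (i + 1) (k + 1) * factor 1 i *
            (rows (fun _ => 1) (i + 2) k * arow 1 (i + 1) (k + 1)) := by
          rw [← h]; simp only [mul_assoc]
      _ = col R i (k + 1 + 1) * rows (fun _ => 1) (i + 1) (k + 1) := rfl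

end Column

/-- The sum of `G` over the words obtained from a word by going through it from right to left and
removing some of the descents met on the way. -/
def bubble : (List ℕ → ℤ) → List ℕ → ℤ
  | G, [] => G []
  | G, a :: l => bubble (fun r => factor 1 0 G (a :: r)) l

theorem factor_one_zero_cons_cons (G : List ℕ → ℤ) (a b : ℕ) (l : List ℕ) :
    factor 1 0 G (a :: b :: l) = G (a :: b :: l) + if b < a then G (b :: a :: l) else 0 := by
  rw [factor_apply, one_mul, desc_zero_cons_cons]

theorem factor_one_zero_singleton (G : List ℕ → ℤ) (a : ℕ) : factor 1 0 G [a] = G [a] := by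
  rw [factor_apply, one_mul, desc_zero_singleton, add_zero]

theorem factor_one_zero_local {G H : List ℕ → ℤ} {l : List ℕ}
    (h : ∀ r : List ℕ, r.Perm l → G r = H r) : factor 1 0 G l = factor 1 0 H l := by
  simpa using factor_map (f := id) 1 0 (strictMono_id.strictMonoOn _) (by simpa using h)

theorem bubble_local {G H : List ℕ → ℤ} {l : List ℕ}
    (h : ∀ r : List ℕ, r.Perm l → G r = H r) : bubble G l = bubble H l := by
  induction l generalizing G H with
  | nil => exact h [] (List.Perm.refl _)
  | cons a l ih =>
    exact ih fun r hr => factor_one_zero_local fun s hs => h s (hs.trans (hr.cons a))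

theorem col_eq_bubble (G : List ℕ → ℤ) (l : List ℕ) (k : ℕ) (hl : l.length = k + 1) :
    col ℤ 0 k G l = bubble G l := by
  have shift : ∀ (i k : ℕ) (G : List ℕ → ℤ) (a : ℕ) (l : List ℕ),
      col ℤ (i + 1) k G (a :: l) = col ℤ i k (fun r => G (a :: r)) l := by
    intro i k
    induction k generalizing i with
    | zero => intros; rfl
    | succ k ih =>
      intro G a l
      simp only [col, Module.End.mul_apply, ih]
      rfl
  induction k generalizing G l with
  | zero =>
    obtain ⟨a, rfl⟩ := List.length_eq_one_iff.1 hl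
    simp [bubble, col, factor_one_zero_singleton]
  | succ k ih =>
    rcases l with _ | ⟨a, l⟩
    · simp at hl
    · rw [col, Module.End.mul_apply, shift, ih _ _ (by simpa using hl)]
      rfl

/-- The value `Υ` of the tail of a word whose first letter is the smallest one. -/
def tailUpsilon : List ℕ → ℤ
  | [] => 1
  | a :: r => if ∀ x ∈ r, a < x then wordUpsilon r else 0

theorem wordUpsilon_eq_bubble (l : List ℕ) (hl : l ≠ []) :
    wordUpsilon l = bubble tailUpsilon l := by
  rcases l with _ | ⟨a, _ | ⟨b, l⟩⟩
  · exact absurd rfl hl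
  · simp [wordUpsilon, bubble, factor_one_zero_singleton, tailUpsilon, rows, sortedInd]
  · have e : (a :: b :: l).length - 1 = l.length + 1 := by simp
    rw [wordUpsilon, e, rows_one_eq_col_mul, Module.End.mul_apply,
      col_eq_bubble _ _ _ (by simp)]
    refine bubble_local fun r hr => ?_
    rcases r with _ | ⟨c, r⟩
    · simpa using hr.length_eq
    have hlen : r.length - 1 = l.length := by
      have := hr.length_eq
      simp only [List.length_cons] at this
      omega
    rw [rows_succ_cons, tailUpsilon, wordUpsilon, hlen]
    -- The remaining rows never move `c`, so it contributes only the constant condition of being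
    -- smallest.
    have key : ∀ s : List ℕ, s.Perm r → sortedInd ℤ (c :: s) =
        ((if ∀ x ∈ r, c < x then (1 : ℤ) else 0) • sortedInd ℤ : List ℕ → ℤ) s := by
      intro s hs
      rw [sortedInd_cons]
      simp [hs.mem_iff]
    rw [rows_local _ _ _ key, map_smul]
    simp

/-- Nothing in `B` can pass μ, and by `hG` an outcome counts only if μ ends up in front. So `B` is
processed freely, after which μ is forced to jump over every letter of `A`. -/
theorem bubble_append_cons (μ : ℕ) (A B : List ℕ) (hA : ∀ x ∈ A, μ < x) (hB : ∀ x ∈ B, μ < x)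
    (G : List ℕ → ℤ) (hG : ∀ c r, μ ≤ c → μ ∈ r → G (c :: r) = 0) :
    bubble G (A ++ μ :: B) = bubble (fun r => G (μ :: (A ++ r))) B := by
  induction A generalizing G with
  | nil =>
    change bubble (fun r => factor 1 0 G (μ :: r)) B = _
    refine bubble_local fun r hr => ?_
    rcases r with _ | ⟨b, r⟩
    · exact factor_one_zero_singleton _ _
    · have : μ < b := hB b (hr.mem_iff.1 (by simp))
      rw [factor_one_zero_cons_cons, if_neg (by omega), add_zero]
      rfl
  | cons a A ih =>
    have ha : μ < a := hA a (by simp)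
    refine (ih (fun x hx => hA x (List.mem_cons_of_mem _ hx)) _ fun c r hc hr => ?_).trans ?_
    · rw [factor_one_zero_cons_cons, hG a _ ha.le (List.mem_cons_of_mem _ hr),
        hG c _ hc (List.mem_cons_of_mem _ hr)]
      simp
    · congr 1
      funext r
      rw [factor_one_zero_cons_cons, hG a _ ha.le (by simp), if_pos ha, zero_add]
      rfl

theorem wordUpsilon_append_cons (μ : ℕ) (A B : List ℕ) (hA : ∀ x ∈ A, μ < x)
    (hB : ∀ x ∈ B, μ < x) :
    wordUpsilon (A ++ μ :: B) = bubble (fun r => wordUpsilon (A ++ r)) B := by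
  rw [wordUpsilon_eq_bubble _ (by simp), bubble_append_cons μ A B hA hB]
  · refine bubble_local fun r hr => ?_
    rw [tailUpsilon, if_pos]
    intro x hx
    rcases List.mem_append.1 hx with h | h
    · exact hA x h
    · exact hB x (hr.mem_iff.1 h)
  · intro c r hc hr
    rw [tailUpsilon, if_neg]
    intro h
    have := h μ hr
    omega

/-! ### The sum over words as a sum over jumps

The word still to be processed is stored in reverse. -/

/-- The sum of `K` over the outcomes with the letter `m` travelling to the left. -/
def carrySum (K : List ℕ → ℤ) : List ℕ → ℕ → List ℕ → ℤ
  | [], m, R => K (m :: R)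
  | a :: B, m, R => carrySum K B a (m :: R) + if m < a then carrySum K B m (a :: R) else 0

/-- The sum of `K` over all outcomes. -/
def passSum (K : List ℕ → ℤ) : List ℕ → List ℕ → ℤ
  | [], R => K R
  | m :: B, R => carrySum K B m R

/-- The sum of `K` over the outcomes in which the letter `m` jumps at least once. -/
def jumpSum (K : List ℕ → ℤ) : List ℕ → ℕ → List ℕ → ℤ
  | [], _, _ => 0
  | a :: B, m, R => if m < a then carrySum K B m (a :: R) else 0

theorem carrySum_eq (K : List ℕ → ℤ) (B : List ℕ) (m : ℕ) (R : List ℕ) :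
    carrySum K B m R = passSum K B (m :: R) + jumpSum K B m R := by
  cases B <;> simp [carrySum, passSum, jumpSum]

theorem passSum_cons (K : List ℕ → ℤ) (B : List ℕ) (m : ℕ) (R : List ℕ) :
    passSum K (m :: B) R = passSum K B (m :: R) + jumpSum K B m R := carrySum_eq K B m R

theorem jumpSum_cons (K : List ℕ → ℤ) (B : List ℕ) (a m : ℕ) (R : List ℕ) :
    jumpSum K (a :: B) m R =
      if m < a then passSum K B (m :: a :: R) + jumpSum K B m (a :: R) else 0 := by
  rw [jumpSum, carrySum_eq]

theorem jumpSum_eq_zero (K : List ℕ → ℤ) (B : List ℕ) (m : ℕ) (R : List ℕ)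
    (h : ∀ c ∈ B, ¬ m < c) : jumpSum K B m R = 0 := by
  rcases B with _ | ⟨a, B⟩
  · rfl
  · rw [jumpSum, if_neg (h a (by simp))]

/-- In the reversed storage `b` is the leftmost letter and is met last, so its step can be absorbed
into `K`. -/
theorem carrySum_concat (K : List ℕ → ℤ) (B : List ℕ) (b m : ℕ) (R : List ℕ) :
    carrySum K (B ++ [b]) m R = carrySum (fun r => factor 1 0 K (b :: r)) B m R := by
  induction B generalizing m R with
  | nil => simp only [List.nil_append, carrySum, factor_one_zero_cons_cons]
  | cons a B ih => simp only [List.cons_append, carrySum, ih]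

theorem bubble_concat (K : List ℕ → ℤ) (B : List ℕ) (m : ℕ) :
    bubble K (B ++ [m]) = carrySum K B.reverse m [] := by
  induction B generalizing K with
  | nil => exact factor_one_zero_singleton _ _
  | cons b B ih =>
    rw [List.reverse_cons, carrySum_concat, ← ih]
    rfl

theorem bubble_eq_passSum (K : List ℕ → ℤ) (B : List ℕ) :
    bubble K B = passSum K B.reverse [] := by
  rcases List.eq_nil_or_concat B with rfl | ⟨B, m, rfl⟩
  · rfl
  · rw [List.concat_eq_append, bubble_concat, List.reverse_append]
    rfl

/-! ### Totally monotone set functions -/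

/-- The set functions which are sums of indicator functions `T ↦ [S ⊆ T]`. -/
def totallyMonotone : AddSubmonoid (Finset ℕ → ℤ) :=
  AddSubmonoid.closure (Set.range fun S T => if S ⊆ T then 1 else 0)

theorem indicator_mem_totallyMonotone (S : Finset ℕ) :
    (fun T => if S ⊆ T then 1 else 0) ∈ totallyMonotone :=
  AddSubmonoid.subset_closure ⟨S, rfl⟩

theorem exists_coeff_of_mem_totallyMonotone {f : Finset ℕ → ℤ} (hf : f ∈ totallyMonotone) :
    ∃ c : Finset ℕ → ℤ, (∀ S, 0 ≤ c S) ∧ ∀ T, f T = ∑ S ∈ T.powerset, c S := by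
  induction hf using AddSubmonoid.closure_induction with
  | mem f hf =>
    obtain ⟨S, rfl⟩ := hf
    refine ⟨fun S' => if S' = S then 1 else 0, fun S' => by positivity, fun T => ?_⟩
    simp
  | zero => exact ⟨0, fun _ => le_rfl, fun T => by simp⟩
  | add f g _ _ hf hg =>
    obtain ⟨c, hc, hc'⟩ := hf
    obtain ⟨d, hd, hd'⟩ := hg
    refine ⟨c + d, fun S => add_nonneg (hc S) (hd S), fun T => ?_⟩
    simp [hc', hd', Finset.sum_add_distrib]

/-- The alternating sums of a totally monotone function over intervals are nonnegative. -/
theorem sum_Icc_nonneg {f : Finset ℕ → ℤ} (hf : f ∈ totallyMonotone) (U W : Finset ℕ) :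
    0 ≤ ∑ T ∈ Finset.Icc U W, (-1 : ℤ) ^ (W.card - T.card) * f T := by
  induction hf using AddSubmonoid.closure_induction with
  | mem f hf =>
    obtain ⟨S, rfl⟩ := hf
    have h : ∑ T ∈ Finset.Icc U W, (-1 : ℤ) ^ (W.card - T.card) * (if S ⊆ T then 1 else 0) =
        ∑ T ∈ Finset.Icc (U ∪ S) W, (-1 : ℤ) ^ (W.card - T.card) := by
      simp only [mul_ite, mul_one, mul_zero]
      rw [← Finset.sum_filter]
      refine Finset.sum_congr ?_ fun _ _ => rfl
      ext T
      simp only [Finset.mem_filter, Finset.mem_Icc, Finset.union_subset_iff]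
      tauto
    rw [h]
    generalize U ∪ S = V
    by_cases hV : V ⊆ W
    · rw [Finset.Icc_eq_image_powerset hV, Finset.sum_image]
      · have h2 : ∀ x ∈ (W \ V).powerset, (-1 : ℤ) ^ (W.card - (V ∪ x).card) =
            (-1) ^ (W \ V).card * (-1) ^ x.card := by
          intro x hx
          rw [Finset.mem_powerset] at hx
          have hd : Disjoint V x :=
            Finset.disjoint_left.2 fun y hy hy' => (Finset.mem_sdiff.1 (hx hy')).2 hy
          have hc := Finset.card_le_card hx
          have hc2 := Finset.card_sdiff_add_card_eq_card hV
          rw [Finset.card_union_of_disjoint hd, ← pow_add,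
            -- The two exponents differ by an even number, which removes the truncated subtraction.
            show (W \ V).card + x.card = (W.card - (V.card + x.card)) + 2 * x.card by omega,
            pow_add, pow_mul]
          simp
        rw [Finset.sum_congr rfl h2, ← Finset.mul_sum, Finset.sum_powerset_neg_one_pow_card]
        split_ifs with h3
        · simp [h3]
        · simp
      · intro x hx y hy hxy
        simp only [Finset.coe_powerset, Set.mem_preimage, Set.mem_powerset_iff,
          Finset.coe_subset] at hx hy
        have h3 : ∀ z, z ⊆ W \ V → (V ∪ z) \ V = z := by
          intro z hz
          rw [Finset.union_sdiff_left, Finset.sdiff_eq_self_iff_disjoint]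
          exact Finset.disjoint_left.2 fun y hy hy' => (Finset.mem_sdiff.1 (hz hy)).2 hy'
        rw [← h3 x hx, ← h3 y hy]
        exact congrArg (· \ V) hxy
    · rw [Finset.Icc_eq_empty hV]; simp
  | zero => simp
  | add f g _ _ hf hg =>
    simp only [Pi.add_apply, mul_add, Finset.sum_add_distrib]
    exact add_nonneg hf hg

/-! ### Restrictions of words -/

/-- The subword of the letters in `T`. -/
def res (T : Finset ℕ) (l : List ℕ) : List ℕ := l.filter (· ∈ T)

theorem res_append (T : Finset ℕ) (l l' : List ℕ) : res T (l ++ l') = res T l ++ res T l' :=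
  List.filter_append _ _

theorem res_cons_of_mem {T : Finset ℕ} {a : ℕ} (h : a ∈ T) (l : List ℕ) :
    res T (a :: l) = a :: res T l := by simp [res, h]

theorem res_cons_of_notMem {T : Finset ℕ} {a : ℕ} (h : a ∉ T) (l : List ℕ) :
    res T (a :: l) = res T l := by simp [res, h]

theorem res_reverse (T : Finset ℕ) (l : List ℕ) : res T l.reverse = (res T l).reverse := by
  simp [res]

theorem res_sublist (T : Finset ℕ) (l : List ℕ) : (res T l).Sublist l := List.filter_sublist

/-! ### Patterns 1423 with a marked letter -/

/-- Every occurrence of `1423` has its letter `2` in `F`. -/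
def Marked (F : Finset ℕ) (W : List ℕ) : Prop :=
  ∀ x c a b, [x, c, a, b].Sublist W → x < a → a < b → b < c → a ∈ F

/-- Every occurrence of `312` in `Z` and of `1423` in `A ++ Z` has its letter `1`, respectively `2`,
in `F`. -/
def MarkedPair (F : Finset ℕ) (A Z : List ℕ) : Prop :=
  (∀ c a b, [c, a, b].Sublist Z → a < b → b < c → a ∈ F) ∧ Marked F (A ++ Z)

theorem MarkedPair.mono {F F' : Finset ℕ} {A Z : List ℕ} (h : MarkedPair F A Z) (hF : F ⊆ F') :
    MarkedPair F' A Z :=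
  ⟨fun c a b hs h1 h2 => hF (h.1 c a b hs h1 h2),
    fun x c a b hs h1 h2 h3 => hF (h.2 x c a b hs h1 h2 h3)⟩

theorem sublist_swap {l p q : List ℕ} {m a : ℕ} (h : l.Sublist (p ++ m :: a :: q)) :
    l.Sublist (p ++ a :: m :: q) ∨
      ∃ l₁ l₂, l = l₁ ++ m :: a :: l₂ ∧ l₁.Sublist p ∧ l₂.Sublist q := by
  obtain ⟨l₁, l', rfl, h1, h2⟩ := List.sublist_append_iff.1 h
  rcases List.sublist_cons_iff.1 h2 with h3 | ⟨r, rfl, h3⟩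
  · left
    refine h1.append (h3.trans ?_)
    exact (List.sublist_cons_self m q).cons_cons a
  · rcases List.sublist_cons_iff.1 h3 with h4 | ⟨s, rfl, h4⟩
    · left
      exact h1.append ((h4.cons_cons m).cons a)
    · exact Or.inr ⟨l₁, s, rfl, h1, h4⟩

/-- A new occurrence uses `m` immediately before `a`. With `m < a`, either `m` is the letter
required to be marked, or `m` and `a` play 1 and 4 in a 1423; in that case `a` starts a 312 in the
old word, whose 1 is already marked. -/
theorem MarkedPair.swap {F : Finset ℕ} {A Z₁ Z₂ : List ℕ} {a m : ℕ}
    (h : MarkedPair F A (Z₁ ++ a :: m :: Z₂)) (hma : m < a) (hm : m ∈ F) :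
    MarkedPair F A (Z₁ ++ m :: a :: Z₂) := by
  constructor
  · intro c a' b' hs h1 h2
    rcases sublist_swap hs with hs | ⟨l₁, l₂, e, -, -⟩
    · exact h.1 c a' b' hs h1 h2
    · rcases l₁ with _ | ⟨y₁, _ | ⟨y₂, _ | ⟨y₃, l₁⟩⟩⟩ <;> simp at e
      · omega
      · rw [e.2.1]; exact hm
  · intro x c a' b' hs h1 h2 h3
    rw [← List.append_assoc] at hs
    rcases sublist_swap hs with hs | ⟨l₁, l₂, e, -, hl₂⟩
    · rw [List.append_assoc] at hs
      exact h.2 x c a' b' hs h1 h2 h3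
    · rcases l₁ with _ | ⟨y₁, _ | ⟨y₂, _ | ⟨y₃, _ | ⟨y₄, l₁⟩⟩⟩⟩ <;> simp at e
      · obtain ⟨rfl, rfl, rfl⟩ := e
        refine h.1 c a' b' ?_ h2 h3
        exact ((hl₂.cons x).cons_cons c).trans (List.sublist_append_right _ _)
      · omega
      · rw [e.2.2.1]; exact hm

/-! ### Total monotonicity of `Υ` -/

/-- Induction over the letters still to be passed. The first part concerns the excess of the pass
over the outcome without jumps, the second the outcomes where a marked letter `m` jumps. Both are
needed at once: a pass starts jumps, and a jumping letter that stops starts a new pass. -/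
theorem pass_jump_mem_totallyMonotone (n : ℕ)
    (ih : ∀ (F : Finset ℕ) (W : List ℕ), W.length = n → W.Nodup → Marked F W →
      (fun T => if F ⊆ T then wordUpsilon (res T W) else 0) ∈ totallyMonotone)
    (A B : List ℕ) :
    (∀ (F : Finset ℕ) (R : List ℕ), (A ++ (B.reverse ++ R)).length = n →
      (A ++ (B.reverse ++ R)).Nodup → MarkedPair F A (B.reverse ++ R) →
      (fun T => if F ⊆ T then passSum (fun r => wordUpsilon (res T A ++ r)) (res T B) (res T R) -
        wordUpsilon (res T (A ++ (B.reverse ++ R))) else 0) ∈ totallyMonotone) ∧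
    (∀ (F : Finset ℕ) (m : ℕ) (R : List ℕ), m ∈ F → (A ++ (B.reverse ++ m :: R)).length = n →
      (A ++ (B.reverse ++ m :: R)).Nodup → MarkedPair F A (B.reverse ++ m :: R) →
      (fun T => if F ⊆ T then jumpSum (fun r => wordUpsilon (res T A ++ r)) (res T B) m (res T R)
        else 0) ∈ totallyMonotone) := by
  induction B with
  | nil =>
    constructor
    · intro F R _ _ _
      convert zero_mem totallyMonotone using 2 with T
      simp [passSum, res]
    · intro F m R _ _ _ _
      convert zero_mem totallyMonotone using 2 with T
      simp [jumpSum, res]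
  | cons a B ihB =>
    obtain ⟨ihP, ihJ⟩ := ihB
    have er : ∀ R : List ℕ, (a :: B).reverse ++ R = B.reverse ++ a :: R := fun R => by simp
    constructor
    · intro F R hlen hnd hF
      rw [er] at hlen hnd hF ⊢
      -- Either `a` stays in place, or it jumps; the latter requires `a ∈ T`, so `a` becomes marked.
      convert add_mem (ihP F (a :: R) hlen hnd hF)
        (ihJ (insert a F) a R (Finset.mem_insert_self _ _) hlen hnd
          (hF.mono (Finset.subset_insert _ _))) using 2 with T
      simp only [Pi.add_apply, Finset.insert_subset_iff]
      by_cases ha : a ∈ T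
      · simp only [ha, true_and, res_cons_of_mem ha, passSum_cons]
        split_ifs <;> ring
      · simp only [ha, false_and, res_cons_of_notMem ha, if_false, add_zero]
    · intro F m R hm hlen hnd hF
      rw [er] at hlen hnd hF
      rcases lt_trichotomy m a with hma | rfl | ham
      -- If `a ∈ T`, then `m` jumps over it and either stops, leaving a full pass (its excess plus Υ
      -- of the swapped word), or jumps on. If `a ∉ T`, only the third summand is nonzero, and it
      -- ignores `a`.
      · have hF' := hF.swap hma hm
        have hp : (A ++ (B.reverse ++ m :: a :: R)).Perm (A ++ (B.reverse ++ a :: m :: R)) :=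
          ((List.Perm.swap _ _ _).append_left _).append_left _
        have hlen' := hp.length_eq.trans hlen
        have hnd' := hp.nodup_iff.2 hnd
        have hF'' := hF'.mono (Finset.subset_insert a F)
        convert add_mem (add_mem (ihP (insert a F) (m :: a :: R) hlen' hnd' hF'')
          (ih (insert a F) _ hlen' hnd' hF''.2)) (ihJ F m (a :: R) hm hlen' hnd' hF')
          using 2 with T
        simp only [Pi.add_apply, Finset.insert_subset_iff]
        by_cases hFT : F ⊆ T
        · by_cases ha : a ∈ T
          · simp only [ha, hFT, true_and, res_cons_of_mem ha, res_cons_of_mem (hFT hm),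
              jumpSum_cons, if_pos hma, if_true]
            ring
          · simp only [ha, hFT, false_and, res_cons_of_notMem ha, if_false, if_true, add_zero,
              zero_add]
        · simp [hFT]
      · simp [List.nodup_append] at hnd
      -- A present `a` blocks `m`. If `a` were absent and `m` could jump over some `c`, then `c a m`
      -- would be a 312, forcing `a ∈ F ⊆ T`.
      · convert zero_mem totallyMonotone using 2 with T
        simp only [Pi.zero_apply, ite_eq_right_iff]
        intro hFT
        by_cases ha : a ∈ T
        · rw [res_cons_of_mem ha, jumpSum_cons, if_neg (by omega)]
        · rw [res_cons_of_notMem ha]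
          refine jumpSum_eq_zero _ _ _ _ fun c hc hmc => ha (hFT (hF.1 c a m ?_ ham hmc))
          have h1 : [c].Sublist B.reverse := by
            rw [List.singleton_sublist, List.mem_reverse]
            exact (res_sublist T B).mem hc
          have h2 : [a, m].Sublist (a :: m :: R) := ((List.nil_sublist R).cons_cons m).cons_cons a
          exact h1.append h2

theorem exists_min_split (W : List ℕ) (hW : W ≠ []) (hnd : W.Nodup) :
    ∃ A μ B, W = A ++ μ :: B ∧ (∀ x ∈ A, μ < x) ∧ ∀ x ∈ B, μ < x := by
  obtain ⟨μ, hμ, hmin⟩ := W.toFinset.exists_min_image id (by simpa using hW)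
  obtain ⟨A, B, rfl⟩ := List.append_of_mem (List.mem_toFinset.1 hμ)
  refine ⟨A, μ, B, rfl, fun x hx => ?_, fun x hx => ?_⟩
  · refine lt_of_le_of_ne (hmin x (by simp [hx])) ?_
    rintro rfl
    exact ((List.nodup_append.1 hnd).2.2 μ hx μ (by simp)) rfl
  · refine lt_of_le_of_ne (hmin x (by simp [hx])) ?_
    rintro rfl
    simp [List.nodup_append, hx] at hnd

/-- If the letter `2` of every occurrence of `1423` is marked, then `Υ` of the restrictions of the
word which contain all marked letters is totally monotone. -/
theorem wordUpsilon_res_mem_totallyMonotone (n : ℕ) (F : Finset ℕ) (W : List ℕ)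
    (hn : W.length = n) (hnd : W.Nodup) (hF : Marked F W) :
    (fun T => if F ⊆ T then wordUpsilon (res T W) else 0) ∈ totallyMonotone := by
  induction n generalizing F W with
  | zero =>
    obtain rfl := List.length_eq_zero_iff.1 hn
    convert indicator_mem_totallyMonotone F using 2 with T
    simp [res, wordUpsilon, rows, sortedInd]
  | succ n ih =>
    obtain ⟨A, μ, B, rfl, hA, hB⟩ := exists_min_split W (by rintro rfl; simp at hn) hnd
    have hs : (A ++ B).Sublist (A ++ μ :: B) :=
      (List.Sublist.refl A).append (List.sublist_cons_self μ B)
    have hlen : (A ++ B).length = n := by simp at hn ⊢; omega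
    have hnd' := hnd.sublist hs
    have hF1 : Marked F (A ++ B) := fun x c a b h => hF x c a b (h.trans hs)
    have hF2 : MarkedPair F A B := by
      refine ⟨fun c a b h => hF μ c a b ?_ (hB a (h.mem (by simp))), hF1⟩
      exact (h.cons_cons μ).trans (List.sublist_append_right _ _)
    -- For `μ ∉ T` the value is Υ of the restriction of `A ++ B`; the excess of the pass is added
    -- only when `μ ∈ T`, hence the marking of `μ`.
    have hP := (pass_jump_mem_totallyMonotone n ih A B.reverse).1 (insert μ F) []
      (by simpa using hlen) (by simpa using hnd')
      (by simpa using hF2.mono (Finset.subset_insert μ F))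
    convert add_mem hP (ih F (A ++ B) hlen hnd' hF1) using 2 with T
    simp only [Pi.add_apply, Finset.insert_subset_iff, List.reverse_reverse, List.append_nil]
    by_cases hμ : μ ∈ T
    · rw [res_append, res_cons_of_mem hμ, wordUpsilon_append_cons, bubble_eq_passSum, res_reverse]
      · simp only [hμ, true_and, res, List.filter_nil]
        split_ifs <;> ring
      · exact fun x hx => hA x ((res_sublist T A).mem hx)
      · exact fun x hx => hB x ((res_sublist T B).mem hx)
    · rw [res_append, res_cons_of_notMem hμ, ← res_append]
      simp [hμ]

/-! ### Standardization -/

/-- The rank of `x` among the letters of `l`, counted from `1`. -/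
def rank (l : List ℕ) (x : ℕ) : ℕ := l.countP (· ≤ x)

theorem countP_ofFn {n : ℕ} (g : Fin n → ℕ) (p : ℕ → Prop) [DecidablePred p] :
    (List.ofFn g).countP p = (Finset.univ.filter fun i => p (g i)).card := by
  rw [Finset.card_def, Finset.filter_val, ← Multiset.countP_eq_card_filter,
    List.ofFn_eq_map, List.countP_map]
  rfl

theorem card_filter_perm_le {n : ℕ} (w : Equiv.Perm (Fin n)) (i : Fin n) :
    (Finset.univ.filter fun j => w j ≤ w i).card = (w i : ℕ) + 1 := by
  rw [← Fin.card_Iic, ← Finset.card_map w.toEmbedding]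
  congr 1
  ext k
  simp only [Finset.mem_map, Finset.mem_filter, Finset.mem_univ, true_and,
    Equiv.coe_toEmbedding, Finset.mem_Iic]
  exact ⟨by rintro ⟨j, hj, rfl⟩; exact hj, fun hk => ⟨w.symm k, by simpa using hk, by simp⟩⟩

theorem oneLine_wordPerm (l : List ℕ) (hl : l.Nodup) :
    oneLine (wordPerm l) = l.map (rank l) := by
  apply List.ext_getElem
  · simp [length_oneLine]
  · intro i h1 h2
    have hi : i < l.length := by simpa using h2
    have e : rank l l[i] = (Finset.univ.filter fun j : Fin l.length => l.get j ≤ l[i]).card := by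
      rw [rank]
      generalize l[i] = x
      rw [← countP_ofFn l.get (· ≤ x), List.ofFn_get]
    simp only [oneLine, List.getElem_ofFn, List.getElem_map]
    rw [e, ← card_filter_perm_le]
    congr 1
    ext j
    simp only [Finset.mem_filter, Finset.mem_univ, true_and]
    rw [← not_lt, wordPerm_lt_iff l hl, not_lt]
    rfl

theorem oneLine_nodup {n : ℕ} (w : Equiv.Perm (Fin n)) : (oneLine w).Nodup := by
  refine List.nodup_ofFn.2 fun i j h => w.injective (Fin.ext ?_)
  simpa using h

theorem oneLine_wordPerm_oneLine {n : ℕ} (w : Equiv.Perm (Fin n)) :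
    oneLine (wordPerm (oneLine w)) = oneLine w := by
  rw [oneLine_wordPerm _ (oneLine_nodup w)]
  apply List.ext_getElem
  · simp
  · intro i h1 h2
    have e : rank (oneLine w) ((oneLine w)[i]) = _ := countP_ofFn _ _
    rw [List.getElem_map, e]
    simp only [oneLine, List.getElem_ofFn, add_le_add_iff_right, Fin.val_fin_le]
    exact card_filter_perm_le w _

theorem rank_strictMonoOn (l : List ℕ) : StrictMonoOn (rank l) {x | x ∈ l} := by
  intro x _ y hy hxy
  have hsub : (l.filter (· ≤ x)).Sublist ((l.filter (· ≤ y)).erase y) := by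
    have h1 : (l.filter (· ≤ x)).Sublist (l.filter (· ≤ y)) :=
      List.monotone_filter_right l fun a ha => by simp at ha ⊢; omega
    have h2 := h1.erase y
    rwa [List.erase_of_not_mem (by simp; omega)] at h2
  have hmem : y ∈ l.filter (· ≤ y) := by simpa using hy
  have h3 := hsub.length_le
  have h4 := List.length_pos_of_mem hmem
  rw [List.length_erase_of_mem hmem] at h3
  rw [rank, rank, List.countP_eq_length_filter, List.countP_eq_length_filter]
  omega

theorem oneLine_wordPerm_map {f : ℕ → ℕ} {l : List ℕ} (hl : l.Nodup)
    (hf : StrictMonoOn f {x | x ∈ l}) :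
    oneLine (wordPerm (l.map f)) = oneLine (wordPerm l) := by
  rw [oneLine_wordPerm _ hl, oneLine_wordPerm _ (hl.map_on fun x hx y hy h => hf.injOn hx hy h),
    List.map_map]
  refine List.map_congr_left fun x hx => ?_
  rw [Function.comp_apply, rank, rank, List.countP_map]
  refine List.countP_congr fun y hy => ?_
  simpa using hf.le_iff_le hy hx

theorem upsilon_wordPerm (l : List ℕ) (hl : l.Nodup) : upsilon (wordPerm l) = wordUpsilon l := by
  rw [upsilon_eq_wordUpsilon, oneLine_wordPerm l hl, wordUpsilon_map (rank_strictMonoOn l)]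

/-! ### Sums over patterns as sums over subwords -/

theorem coeffC_congr {m n : ℕ} {u : Equiv.Perm (Fin m)} {v : Equiv.Perm (Fin n)}
    (h : oneLine u = oneLine v) : coeffC u = coeffC v := by
  obtain rfl : m = n := by rw [← length_oneLine u, h, length_oneLine]
  congr 1
  ext i
  have := congrFun (List.ofFn_injective h) i
  simpa using this

/-- Double counting: each subword of length `m` is an occurrence of exactly one pattern. -/
theorem sum_patternCount {n : ℕ} (w : Equiv.Perm (Fin n)) (m : ℕ) :
    ∑ v : Equiv.Perm (Fin m), coeffC v * (patternCount v w : ℤ) =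
      ∑ l ∈ wordsBetween [] (oneLine w) with l.length = m, coeffC (wordPerm l) := by
  have h1 : ∀ v : Equiv.Perm (Fin m), coeffC v * (patternCount v w : ℤ) =
      ∑ l ∈ wordsBetween [] (oneLine w),
        if oneLine (wordPerm l) = oneLine v then coeffC (wordPerm l) else 0 := by
    intro v
    rw [← Finset.sum_filter, Finset.sum_congr rfl fun l hl =>
      coeffC_congr (Finset.mem_filter.1 hl).2, Finset.sum_const, nsmul_eq_mul, mul_comm]
    rfl
  rw [Finset.sum_congr rfl fun v _ => h1 v, Finset.sum_comm, Finset.sum_filter]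
  refine Finset.sum_congr rfl fun l _ => ?_
  split_ifs with hm
  · subst hm
    rw [Finset.sum_eq_single (wordPerm l)]
    · simp
    · intro v _ hv
      rw [if_neg]
      intro h
      refine hv (Equiv.ext fun i => Fin.ext ?_)
      have := congrFun (List.ofFn_injective h) i
      simpa using this.symm
    · simp
  · refine Finset.sum_eq_zero fun v _ => if_neg fun h => hm ?_
    rw [← length_oneLine (wordPerm l), h, length_oneLine]

theorem sum_range_patternCount {n : ℕ} (w : Equiv.Perm (Fin n)) (k : ℕ) :
    ∑ m ∈ Finset.range k, ∑ v : Equiv.Perm (Fin m), coeffC v * (patternCount v w : ℤ) =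
      ∑ l ∈ wordsBetween [] (oneLine w) with l.length < k, coeffC (wordPerm l) := by
  rw [Finset.sum_congr rfl fun m _ => sum_patternCount w m]
  simp_rw [Finset.sum_filter]
  rw [Finset.sum_comm]
  refine Finset.sum_congr rfl fun l _ => ?_
  simp

theorem sum_wordsBetween_eq {n : ℕ} (w : Equiv.Perm (Fin n)) :
    ∑ l ∈ wordsBetween [] (oneLine w), coeffC (wordPerm l) =
      ∑ m ∈ Finset.range (n + 1), ∑ v : Equiv.Perm (Fin m),
        coeffC v * (patternCount v w : ℤ) := by
  rw [sum_range_patternCount, Finset.filter_true_of_mem]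
  intro l hl
  have := ((mem_wordsBetween _ _ _).1 hl).2.length_le
  rw [length_oneLine] at this
  omega

theorem upsilon_eq_sum_subwords {n : ℕ} (w : Equiv.Perm (Fin n)) :
    upsilon w = ∑ l ∈ wordsBetween [] (oneLine w), coeffC (wordPerm l) := by
  have htop : ∑ l ∈ wordsBetween [] (oneLine w) with l.length = n, coeffC (wordPerm l) =
      coeffC w := by
    have : (wordsBetween [] (oneLine w)).filter (fun l => l.length = n) = {oneLine w} := by
      ext l
      simp only [Finset.mem_filter, mem_wordsBetween, List.nil_sublist, true_and,
        Finset.mem_singleton]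
      constructor
      · rintro ⟨h1, h2⟩
        exact h1.eq_of_length (h2.trans (length_oneLine w).symm)
      · rintro rfl
        exact ⟨List.Sublist.refl _, length_oneLine w⟩
    rw [this, Finset.sum_singleton]
    exact coeffC_congr (oneLine_wordPerm_oneLine w)
  rw [sum_wordsBetween_eq, Finset.sum_range_succ, sum_patternCount, htop]
  rcases n with _ | n
  · simp [upsilon_eq_wordUpsilon, oneLine, wordUpsilon, rows, sortedInd, coeffC]
  · rw [coeffC, Finset.sum_range]
    ring

/-- Standardizing `W` relabels its letters increasingly, which changes neither Υ nor the patterns of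
subwords. -/
theorem wordUpsilon_eq_sum_subwords (W : List ℕ) (hW : W.Nodup) :
    wordUpsilon W = ∑ l ∈ wordsBetween [] W, coeffC (wordPerm l) := by
  have hb : ∀ V : List ℕ, wordsBetween [] V = V.sublists.toFinset := fun V => by
    simp [wordsBetween]
  have hr := rank_strictMonoOn W
  have hmap : (W.map (rank W)).Nodup := hW.map_on fun x hx y hy h => hr.injOn hx hy h
  rw [← upsilon_wordPerm W hW, upsilon_eq_sum_subwords, oneLine_wordPerm W hW, hb, hb,
    List.sum_toFinset _ (List.nodup_sublists.2 hmap), List.sum_toFinset _ (List.nodup_sublists.2 hW),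
    List.sublists_map, List.map_map]
  congr 1
  refine List.map_congr_left fun l hl => ?_
  rw [List.mem_sublists] at hl
  exact coeffC_congr (oneLine_wordPerm_map (hW.sublist hl) (hr.mono fun x hx => hl.mem hx))

/-! ### Subwords as sets of letters -/

theorem res_toFinset {l W : List ℕ} (hW : W.Nodup) (h : l.Sublist W) : res l.toFinset W = l := by
  have h1 : l.Sublist (res l.toFinset W) := by
    have := h.filter (· ∈ l.toFinset)
    rwa [List.filter_eq_self.2 (by simp)] at this
  refine (h1.eq_of_length_le ?_).symm
  have h2 : (res l.toFinset W).Subperm l :=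
    List.subperm_of_subset (hW.sublist (res_sublist _ _)) fun x hx => by
      simpa [res] using (List.mem_filter.1 hx).2
  exact h2.length_le

theorem toFinset_mono_of_sublist {l W : List ℕ} (h : l.Sublist W) : l.toFinset ⊆ W.toFinset :=
  fun _ hx => List.mem_toFinset.2 (h.mem (List.mem_toFinset.1 hx))

theorem toFinset_res {S : Finset ℕ} {W : List ℕ} (h : S ⊆ W.toFinset) :
    (res S W).toFinset = S := by
  ext x
  simp only [res, List.mem_toFinset, List.mem_filter, decide_eq_true_eq, and_iff_right_iff_imp]
  exact fun hx => List.mem_toFinset.1 (h hx)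

theorem res_sublist_res {S T : Finset ℕ} (h : S ⊆ T) (W : List ℕ) :
    (res S W).Sublist (res T W) :=
  List.monotone_filter_right W fun a ha => by simpa using h (by simpa using ha)

theorem res_res {S T : Finset ℕ} (h : S ⊆ T) (W : List ℕ) : res S (res T W) = res S W := by
  rw [res, res, List.filter_filter]
  refine List.filter_congr fun x _ => ?_
  by_cases hx : x ∈ S
  · simp [hx, h hx]
  · simp [hx]

theorem sum_wordsBetween {u W : List ℕ} (hW : W.Nodup) (hu : u.Sublist W) (g : List ℕ → ℤ) :
    ∑ v ∈ wordsBetween u W, g v = ∑ T ∈ Finset.Icc u.toFinset W.toFinset, g (res T W) := by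
  refine Finset.sum_bij' (fun v _ => v.toFinset) (fun T _ => res T W) ?_ ?_ ?_ ?_ ?_
  · intro v hv
    obtain ⟨h1, h2⟩ := (mem_wordsBetween _ _ _).1 hv
    exact Finset.mem_Icc.2 ⟨toFinset_mono_of_sublist h1, toFinset_mono_of_sublist h2⟩
  · intro T hT
    refine (mem_wordsBetween _ _ _).2 ⟨?_, res_sublist _ _⟩
    rw [← res_toFinset hW hu]
    exact res_sublist_res (Finset.mem_Icc.1 hT).1 W
  · intro v hv
    exact res_toFinset hW ((mem_wordsBetween _ _ _).1 hv).2
  · intro T hT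
    exact toFinset_res (Finset.mem_Icc.1 hT).2
  · intro v hv
    rw [res_toFinset hW ((mem_wordsBetween _ _ _).1 hv).2]

/-- Both sides have Υ of the restrictions as their sums over subsets, and such an expansion is
unique, by induction on `S`. -/
theorem coeffC_wordPerm_res {W : List ℕ} (hW : W.Nodup) {c : Finset ℕ → ℤ}
    (hc : ∀ T, wordUpsilon (res T W) = ∑ S ∈ T.powerset, c S) (S : Finset ℕ)
    (hS : S ⊆ W.toFinset) : coeffC (wordPerm (res S W)) = c S := by
  induction S using Finset.strongInduction with
  | H S ih =>
    have hnd : (res S W).Nodup := hW.sublist (res_sublist _ _)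
    have h1 := hc S
    rw [wordUpsilon_eq_sum_subwords _ hnd, sum_wordsBetween hnd (List.nil_sublist _),
      toFinset_res hS, List.toFinset_nil,
      show Finset.Icc ∅ S = S.powerset from by ext; simp,
      ← Finset.sum_erase_add _ _ (Finset.mem_powerset_self S),
      ← Finset.sum_erase_add _ c (Finset.mem_powerset_self S),
      res_res (Finset.Subset.refl S)] at h1
    have h2 : ∑ T ∈ S.powerset.erase S, coeffC (wordPerm (res T (res S W))) =
        ∑ T ∈ S.powerset.erase S, c T := by
      refine Finset.sum_congr rfl fun T hT => ?_
      obtain ⟨hne, hT⟩ := Finset.mem_erase.1 hT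
      rw [Finset.mem_powerset] at hT
      rw [res_res hT]
      exact ih T (Finset.ssubset_iff_subset_ne.2 ⟨hT, hne⟩) (hT.trans hS)
    rw [h2] at h1
    exact add_left_cancel h1

theorem marked_of_avoids {n : ℕ} {w : Equiv.Perm (Fin n)} (hw : Avoids1423 w) (F : Finset ℕ) :
    Marked F (oneLine w) := by
  intro x c a b hs h1 h2 h3
  refine absurd ?_ (hw _ hs)
  rw [oneLine_wordPerm _ ((oneLine_nodup w).sublist hs)]
  simp only [rank, List.map_cons, List.map_nil, List.countP_cons, List.countP_nil,
    decide_eq_true_eq]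
  have e1 : ¬ c ≤ x := by omega
  have e2 : ¬ a ≤ x := by omega
  have e3 : ¬ b ≤ x := by omega
  have e4 : ¬ c ≤ a := by omega
  have e5 : ¬ b ≤ a := by omega
  have e6 : ¬ c ≤ b := by omega
  have f1 : x ≤ c := by omega
  have f2 : a ≤ c := by omega
  have f3 : b ≤ c := by omega
  have f4 : x ≤ a := by omega
  have f5 : x ≤ b := by omega
  have f6 : a ≤ b := by omega
  simp [e1, e2, e3, e4, e5, e6, f1, f2, f3, f4, f5, f6]

end SchubertWords

/-! ### Both conjectures from total monotonicity -/

theorem corollary1p6 {n : ℕ} (w : Equiv.Perm (Fin n)) (hw : SchubertSpec.Avoids1423 w) :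
    (∀ u : List ℕ, List.Sublist u (SchubertSpec.oneLine w) →
      0 ≤ ∑ v ∈ SchubertSpec.wordsBetween u (SchubertSpec.oneLine w),
        (-1 : ℤ) ^ (n - v.length) * SchubertSpec.upsilon (SchubertSpec.wordPerm v)) ∧
    0 ≤ SchubertSpec.coeffC w ∧
    (SchubertSpec.upsilon w = ∑ m ∈ Finset.range (n + 1), ∑ v : Equiv.Perm (Fin m),
        SchubertSpec.coeffC v * (SchubertSpec.patternCount v w : ℤ)) ∧
    (∀ (m : ℕ) (v : Equiv.Perm (Fin m)),
      0 < SchubertSpec.patternCount v w → 0 ≤ SchubertSpec.coeffC v) := by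
  open SchubertSpec SchubertWords in
  have hnd := oneLine_nodup w
  have hf : (fun T => wordUpsilon (res T (oneLine w))) ∈ totallyMonotone := by
    -- Avoidance of 1423 is what allows the empty set of marked letters.
    convert wordUpsilon_res_mem_totallyMonotone _ ∅ _ rfl hnd (marked_of_avoids hw ∅) using 2 with T
    simp
  obtain ⟨c, hc0, hc⟩ := exists_coeff_of_mem_totallyMonotone hf
  have hsub : ∀ l : List ℕ, l.Sublist (oneLine w) → 0 ≤ coeffC (wordPerm l) := by
    intro l hl
    rw [← res_toFinset hnd hl, coeffC_wordPerm_res hnd hc _ (toFinset_mono_of_sublist hl)]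
    exact hc0 _
  refine ⟨fun u hu => ?_, ?_, ?_, fun m v hv => ?_⟩
  · rw [sum_wordsBetween hnd hu]
    refine (sum_Icc_nonneg hf u.toFinset (oneLine w).toFinset).trans_eq
      (Finset.sum_congr rfl fun T hT => ?_)
    have hT' := hnd.sublist (res_sublist T (oneLine w))
    rw [upsilon_wordPerm _ hT', List.toFinset_card_of_nodup hnd, length_oneLine,
      ← List.toFinset_card_of_nodup hT', toFinset_res (Finset.mem_Icc.1 hT).2]
  · rw [← coeffC_congr (oneLine_wordPerm_oneLine w)]
    exact hsub _ (List.Sublist.refl _)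
  · rw [upsilon_eq_sum_subwords, sum_wordsBetween_eq]
  · obtain ⟨l, hl⟩ := Finset.card_pos.1 hv
    rw [Finset.mem_filter, mem_wordsBetween] at hl
    rw [← coeffC_congr hl.2]
    exact hsub l hl.1.2
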